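/- Let $n\ge 5$ and let $X\subseteq\mathbb{R}^2$ be a set of $n$ points in convex position, that is, no point of $X$ lies in the convex hull of the other points of $X$. For a distance $d>0$ determined by two points of $X$, let its multiplicity be the number of unordered pairs of distinct points of $X$ at Euclidean distance $d$, and let the diameter of $X$ be the largest distance determined by $X$. Then it is not the case that every distance determined by $X$, other than the diameter, has multiplicity greater than $n$; that is, some distance determined by $X$ that is different from the diameter has multiplicity at most $n$. -/

import Mathlib

noncomputable section

/-- The finite set of distances determined by pairs of distinct points of `X`. -/
def distanceSet (X : Finset (EuclideanSpace ℝ (Fin 2))) : Finset ℝ :=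
  X.offDiag.image fun p => dist p.1 p.2

open Classical in
/-- The multiplicity of the distance `d` in `X`: the number of unordered pairs of distinct points
of `X` that are at distance `d`. -/
def distMultiplicity (X : Finset (EuclideanSpace ℝ (Fin 2))) (d : ℝ) : ℕ :=
  (X.sym2.filter fun e => ∃ p q, p ≠ q ∧ e = s(p, q) ∧ dist p q = d).card

/-- `X` is in convex position: no point of `X` lies in the convex hull of the other points. -/
def InConvexPosition (X : Finset (EuclideanSpace ℝ (Fin 2))) : Prop :=
  ConvexIndependent ℝ (fun x : (X : Set (EuclideanSpace ℝ (Fin 2))) => x.val)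

end

/-! Suppose every distance except the largest, `δ`, occurs at least `n + 1` times. Counting pairs
bounds the number `D` of distances from above, convexity bounds it from below by `⌊n/2⌋`, and near
equality the polygon is so rigid that the count overflows.

The geometric core is `IsDiamArc.exists_shorter`: on a convex arc whose ends realise the diameter,
any other chord of span at least 2 shrinks strictly when a suitable end moves one vertex inwards.
Iterating, a chord of span `k` dominates at least `k` distances (`span_le_card`). Apply this to the
longer of the two arcs cut off by a diameter: `D ≥ m` for both `2m` and `2m + 1` vertices. If `D =
m` in the odd case, every chord of span `m` is a diameter (`main_diagonals_of_odd`).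

Odd `n = 2m + 1`: the count forces `D = m`, so `δ` occurs at least `n` times, and `(m - 1)(n + 1) +
n` exceeds `n.choose 2`.

Even `n = 2(m + 1)`: the count forces `D = m + 1` and a unique diameter, which must join opposite
vertices (`diam_span_even`). Deleting either of its ends leaves a `(2m + 1)`-gon with at most `m`
distances, so the rigidity applies to both. Hence the largest remaining distance `ε` is attained by
all chords of span `m` and by the main diagonals other than the diameter, at least `n + 2` pairs in
all, and the count overflows by one. -/

/-- Twice the signed area of the triangle `p q r`. -/
def orient (p q r : EuclideanSpace ℝ (Fin 2)) : ℝ :=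
  (q 0 - p 0) * (r 1 - p 1) - (q 1 - p 1) * (r 0 - p 0)

theorem dist_le_dist_iff_coord (p q r s : EuclideanSpace ℝ (Fin 2)) :
    dist p q ≤ dist r s ↔
      (p 0 - q 0) ^ 2 + (p 1 - q 1) ^ 2 ≤ (r 0 - s 0) ^ 2 + (r 1 - s 1) ^ 2 := by
  rw [EuclideanSpace.dist_eq, EuclideanSpace.dist_eq, Real.sqrt_le_sqrt_iff (by positivity)]
  simp [Fin.sum_univ_two, Real.dist_eq, sq_abs]

/-! ### Vector inequalities excluding a chord that cannot be shortened -/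

/-- For vectors `e`, `f` with Gram matrix `(E, -x; -x, F)` at an angle of at least `120°`, if
`u = e + w` satisfies `u ⬝ (w + 2 z) ≥ 0`, where `w = p e - q f` and `z = r f - s e`, then
`‖z‖ ≤ ‖w‖`, strictly if `q > 0`. -/
theorem sq_norm_le_of_wide_angle {E F x p q r s : ℝ} (hE : 0 < E) (hF : 0 < F) (hx : 0 < x)
    (hEF : E * F ≤ 4 * x ^ 2) (hxEF : x ^ 2 < E * F)
    (hp : 0 ≤ p) (hq : 0 ≤ q) (hr : 0 ≤ r) (hs : 0 ≤ s)
    (h : 2 * ((1 + p) * r * x + (1 + p) * s * E + q * r * F + q * s * x) ≤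
      (1 + p) * p * E + ((1 + p) * q + q * p) * x + q * q * F) :
    r * r * F + 2 * r * s * x + s * s * E ≤ p * p * E + 2 * p * q * x + q * q * F ∧
      (0 < q → r * r * F + 2 * r * s * x + s * s * E < p * p * E + 2 * p * q * x + q * q * F) := by
  -- In vector terms `Y = -u ⬝ z`, `W = u ⬝ w`, `U = ‖u‖²`, `Z = ‖z‖²`, `N = ‖w‖²`; the hypothesis
  -- `h` is `2 * Y ≤ W`.
  set Y := (1 + p) * r * x + (1 + p) * s * E + q * r * F + q * s * x with hY
  set W := (1 + p) * p * E + ((1 + p) * q + q * p) * x + q * q * F with hW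
  set U := (1 + p) * (1 + p) * E + 2 * (1 + p) * q * x + q * q * F with hU
  set Z := r * r * F + 2 * r * s * x + s * s * E with hZ
  set N := p * p * E + 2 * p * q * x + q * q * F with hN
  have hU0 : 0 < U := by positivity
  have hY0 : 0 ≤ Y := by positivity
  have hYx : ((1 + p) * r + q * s) * x ≤ Y := by
    have : 0 ≤ (1 + p) * s * E + q * r * F := by positivity
    rw [hY]; linarith
  have hcross : Y ^ 2 + ((1 + p) * r - q * s) ^ 2 * (E * F - x ^ 2) = U * Z := by
    rw [hY, hU, hZ]; ring
  -- Both `u` and `-z` lie in the cone spanned by `e` and `-f`, whose opening is at most 60°, so the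
  -- cosine of their angle is at least 1/2.
  have hUZ : U * Z ≤ 4 * Y ^ 2 := by
    have h1 : ((1 + p) * r - q * s) ^ 2 * (E * F - x ^ 2) ≤
        ((1 + p) * r + q * s) ^ 2 * (3 * x ^ 2) := by
      apply mul_le_mul _ (by linarith) (by linarith) (by positivity)
      have : 0 ≤ ((1 + p) * r) * (q * s) := by positivity
      nlinarith
    have h2 : (((1 + p) * r + q * s) * x) ^ 2 ≤ Y ^ 2 := by
      apply pow_le_pow_left₀ (by positivity) hYx
    nlinarith
  have hWY : 4 * Y ^ 2 ≤ W ^ 2 := by nlinarith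
  -- Cauchy–Schwarz with its defect: `u` and `w` are parallel only if `q = 0`, which gives the
  -- strict case.
  have hcauchy : W ^ 2 + q ^ 2 * (E * F - x ^ 2) = U * N := by
    rw [hW, hU, hN]; ring
  constructor
  · have : 0 ≤ q ^ 2 * (E * F - x ^ 2) := mul_nonneg (by positivity) (by linarith)
    exact le_of_mul_le_mul_left (by linarith) hU0
  · intro hq'
    have : 0 < q ^ 2 * (E * F - x ^ 2) := mul_pos (by positivity) (by linarith)
    exact lt_of_mul_lt_mul_left (by linarith) hU0.le

/-- Here `g = l e + k f` is the chord. That neither inward move shortens it (`h1`, `h2`) forces an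
angle of at least 120° between `e` and `f`. Maximality of the diameter (`h3`, `h4`) then gives `‖z‖
≤ ‖w‖` and, by symmetry, `‖w‖ ≤ ‖z‖`, one of them strict. -/
theorem gram_contradiction {E F x l k p q r s : ℝ} (hE : 0 < E) (hF : 0 < F)
    (hxEF : x ^ 2 < E * F) (hl : 1 ≤ l) (hk : 1 ≤ k)
    (hp : 0 ≤ p) (hq : 0 ≤ q) (hr : 0 ≤ r) (hs : 0 ≤ s) (hqs : 0 < q ∨ 0 < s)
    (h1 : (2 * l - 1) * E ≤ 2 * k * x) (h2 : (2 * k - 1) * F ≤ 2 * l * x)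
    (h3 : (1 + p) * (2 * k * x - (2 * l - 1) * E) + q * (2 * k * F - (2 * l - 1) * x) +
      2 * ((1 + p) * r * x + (1 + p) * s * E + q * r * F + q * s * x) ≤
      (1 + p) * p * E + ((1 + p) * q + q * p) * x + q * q * F)
    (h4 : (1 + r) * (2 * l * x - (2 * k - 1) * F) + s * (2 * l * E - (2 * k - 1) * x) +
      2 * ((1 + r) * p * x + (1 + r) * q * F + s * p * E + s * q * x) ≤
      (1 + r) * r * F + ((1 + r) * s + s * r) * x + s * s * E) : False := by
  have hx : 0 < x := by
    have : 0 < (2 * l - 1) * E := mul_pos (by linarith) hE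
    by_contra hx
    push Not at hx
    nlinarith
  have hEF : E * F ≤ 4 * x ^ 2 := by
    -- Multiply `h1` by `h2`; since `l, k ≥ 1`, the factor `(2l - 1)(2k - 1)` is at least `l k`.
    have h5 : ((2 * l - 1) * E) * ((2 * k - 1) * F) ≤ (2 * k * x) * (2 * l * x) :=
      mul_le_mul h1 h2 (mul_nonneg (by linarith) hF.le) (by positivity)
    have h6 : l * k ≤ (2 * l - 1) * (2 * k - 1) :=
      mul_le_mul (by linarith) (by linarith) (by linarith) (by linarith)
    have h7 : l * k * (E * F) ≤ (2 * l - 1) * (2 * k - 1) * (E * F) :=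
      mul_le_mul_of_nonneg_right h6 (by positivity)
    have h8 : 0 < l * k := by positivity
    exact le_of_mul_le_mul_left (by linarith) h8
  have h5 : 0 ≤ 2 * k * F - (2 * l - 1) * x := by
    have : (2 * l - 1) * E * x ≤ 2 * k * x * x := mul_le_mul_of_nonneg_right h1 hx.le
    have h9 : 2 * k * x ^ 2 ≤ 2 * k * (E * F) := mul_le_mul_of_nonneg_left hxEF.le (by positivity)
    have : 0 ≤ E * (2 * k * F - (2 * l - 1) * x) := by linarith
    exact nonneg_of_mul_nonneg_right this hE
  have h6 : 0 ≤ 2 * l * E - (2 * k - 1) * x := by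
    have : (2 * k - 1) * F * x ≤ 2 * l * x * x := mul_le_mul_of_nonneg_right h2 hx.le
    have h9 : 2 * l * x ^ 2 ≤ 2 * l * (E * F) := mul_le_mul_of_nonneg_left hxEF.le (by positivity)
    have : 0 ≤ F * (2 * l * E - (2 * k - 1) * x) := by linarith
    exact nonneg_of_mul_nonneg_right this hF
  have h7 := mul_nonneg hq h5
  have h8 := mul_nonneg hs h6
  have h9 : 0 ≤ (1 + p) * (2 * k * x - (2 * l - 1) * E) :=
    mul_nonneg (by linarith) (by linarith)
  have h10 : 0 ≤ (1 + r) * (2 * l * x - (2 * k - 1) * F) :=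
    mul_nonneg (by linarith) (by linarith)
  -- The first two summands of `h3` are `-u ⬝ (2 g - e)`, just shown to be nonnegative; dropping
  -- them leaves the hypothesis on `u ⬝ (w + 2 z)`.
  obtain ⟨a1, a2⟩ := sq_norm_le_of_wide_angle hE hF hx hEF hxEF hp hq hr hs (by linarith)
  obtain ⟨b1, b2⟩ := sq_norm_le_of_wide_angle (E := F) (F := E) (p := r) (q := s) (r := p) (s := q)
    hF hE hx (by linarith) (by linarith) hr hs hp hq (by linarith)
  rcases hqs with h | h
  · linarith [a2 h]
  · linarith [b2 h]

/-- Coordinate form of `stuck_configuration_false`, in terms of the vectors `e = A' - A`,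
`f = B - B'`, `w = A - O`, `z = Z - B`, `g = B - A`. -/
theorem stuck_vectors_false {e1 e2 f1 f2 w1 w2 z1 z2 g1 g2 : ℝ}
    (hef : 0 < e1 * f2 - e2 * f1) (hwf : 0 ≤ w1 * f2 - w2 * f1) (hwe : 0 ≤ w1 * e2 - w2 * e1)
    (hez : 0 ≤ e1 * z2 - e2 * z1) (hfz : 0 ≤ f1 * z2 - f2 * z1)
    (hne : 0 < w1 * e2 - w2 * e1 ∨ 0 < f1 * z2 - f2 * z1)
    (hl : 0 ≤ (g1 - e1) * f2 - (g2 - e2) * f1) (hk : 0 ≤ e1 * (g2 - f2) - e2 * (g1 - f1))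
    (d1 : (-g1) ^ 2 + (-g2) ^ 2 ≤ (e1 - g1) ^ 2 + (e2 - g2) ^ 2)
    (d2 : (-g1) ^ 2 + (-g2) ^ 2 ≤ (f1 - g1) ^ 2 + (f2 - g2) ^ 2)
    (d3 : (e1 - g1 - z1) ^ 2 + (e2 - g2 - z2) ^ 2 ≤ (-w1 - g1 - z1) ^ 2 + (-w2 - g2 - z2) ^ 2)
    (d4 : (-w1 - g1 + f1) ^ 2 + (-w2 - g2 + f2) ^ 2 ≤
      (-w1 - g1 - z1) ^ 2 + (-w2 - g2 - z2) ^ 2) : False := by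
  obtain ⟨T, hT⟩ : ∃ T, T = e1 * f2 - e2 * f1 := ⟨_, rfl⟩
  rw [← hT] at hef
  -- Cramer's rule in the basis `e`, `f`; the convexity hypotheses become the signs of `p, q, r, s`
  -- and the bounds `l, k ≥ 1`.
  obtain ⟨p, hp⟩ : ∃ p, p = (w1 * f2 - w2 * f1) / T := ⟨_, rfl⟩
  obtain ⟨q, hq⟩ : ∃ q, q = (w1 * e2 - w2 * e1) / T := ⟨_, rfl⟩
  obtain ⟨r, hr⟩ : ∃ r, r = (e1 * z2 - e2 * z1) / T := ⟨_, rfl⟩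
  obtain ⟨s, hs⟩ : ∃ s, s = (f1 * z2 - f2 * z1) / T := ⟨_, rfl⟩
  obtain ⟨l, hl'⟩ : ∃ l, l = (g1 * f2 - g2 * f1) / T := ⟨_, rfl⟩
  obtain ⟨k, hk'⟩ : ∃ k, k = (e1 * g2 - e2 * g1) / T := ⟨_, rfl⟩
  have hT0 : T ≠ 0 := hef.ne'
  have mp := (eq_div_iff hT0).1 hp
  have mq := (eq_div_iff hT0).1 hq
  have mr := (eq_div_iff hT0).1 hr
  have ms := (eq_div_iff hT0).1 hs
  have ml := (eq_div_iff hT0).1 hl'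
  have mk := (eq_div_iff hT0).1 hk'
  have ew1 : w1 = p * e1 - q * f1 := by
    apply mul_right_cancel₀ hT0
    linear_combination w1 * hT - e1 * mp + f1 * mq
  have ez1 : z1 = r * f1 - s * e1 := by
    apply mul_right_cancel₀ hT0
    linear_combination z1 * hT - f1 * mr + e1 * ms
  have eg1 : g1 = l * e1 + k * f1 := by
    apply mul_right_cancel₀ hT0
    linear_combination g1 * hT - e1 * ml - f1 * mk
  have ew2 : w2 = p * e2 - q * f2 := by
    apply mul_right_cancel₀ hT0
    linear_combination w2 * hT - e2 * mp + f2 * mq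
  have ez2 : z2 = r * f2 - s * e2 := by
    apply mul_right_cancel₀ hT0
    linear_combination z2 * hT - f2 * mr + e2 * ms
  have eg2 : g2 = l * e2 + k * f2 := by
    apply mul_right_cancel₀ hT0
    linear_combination g2 * hT - e2 * ml - f2 * mk
  have p0 : 0 ≤ p := by rw [hp]; exact div_nonneg hwf hef.le
  have q0 : 0 ≤ q := by rw [hq]; exact div_nonneg hwe hef.le
  have r0 : 0 ≤ r := by rw [hr]; exact div_nonneg hez hef.le
  have s0 : 0 ≤ s := by rw [hs]; exact div_nonneg hfz hef.le
  have l1 : 1 ≤ l := by rw [hl', one_le_div hef, hT]; linarith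
  have k1 : 1 ≤ k := by rw [hk', one_le_div hef, hT]; linarith
  have qs : 0 < q ∨ 0 < s := by
    rcases hne with h | h
    · left; rw [hq]; exact div_pos h hef
    · right; rw [hs]; exact div_pos h hef
  clear hp hq hr hs hl' hk' mp mq mr ms ml mk hne hl hk hwf hwe hez hfz
  subst ew1 ew2 ez1 ez2 eg1 eg2
  have hgram : (e1 ^ 2 + e2 ^ 2) * (f1 ^ 2 + f2 ^ 2) - (-(e1 * f1 + e2 * f2)) ^ 2 = T ^ 2 := by
    rw [hT]; ring
  have hTT : 0 < T ^ 2 := by positivity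
  have hE : 0 < e1 ^ 2 + e2 ^ 2 := by
    refine lt_of_le_of_ne (by positivity) fun h => ?_
    rw [← h, zero_mul] at hgram
    linarith [sq_nonneg (-(e1 * f1 + e2 * f2))]
  have hF : 0 < f1 ^ 2 + f2 ^ 2 := by
    refine lt_of_le_of_ne (by positivity) fun h => ?_
    rw [← h, mul_zero] at hgram
    linarith [sq_nonneg (-(e1 * f1 + e2 * f2))]
  refine gram_contradiction (x := -(e1 * f1 + e2 * f2)) hE hF (by linarith) l1 k1 p0 q0 r0 s0 qs
    ?_ ?_ ?_ ?_
  · linear_combination d1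
  · linear_combination d2
  · linear_combination d3
  · linear_combination d4

/-- The configuration `O, A, A', B', B, Z` of a convex polygonal arc whose diameter is `O Z`
cannot have both `A' B` and `A B'` at least as long as `A B`. -/
theorem stuck_configuration_false {O A A' B' B Z : EuclideanSpace ℝ (Fin 2)}
    (hef : 0 < (A' 0 - A 0) * (B 1 - B' 1) - (A' 1 - A 1) * (B 0 - B' 0))
    (hwf : 0 ≤ (A 0 - O 0) * (B 1 - B' 1) - (A 1 - O 1) * (B 0 - B' 0))
    (hwe : 0 ≤ (A 0 - O 0) * (A' 1 - A 1) - (A 1 - O 1) * (A' 0 - A 0))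
    (hez : 0 ≤ (A' 0 - A 0) * (Z 1 - B 1) - (A' 1 - A 1) * (Z 0 - B 0))
    (hfz : 0 ≤ (B 0 - B' 0) * (Z 1 - B 1) - (B 1 - B' 1) * (Z 0 - B 0))
    (hne : 0 < (A 0 - O 0) * (A' 1 - A 1) - (A 1 - O 1) * (A' 0 - A 0) ∨
      0 < (B 0 - B' 0) * (Z 1 - B 1) - (B 1 - B' 1) * (Z 0 - B 0))
    (hl : 0 ≤ (B 0 - A' 0) * (B 1 - B' 1) - (B 1 - A' 1) * (B 0 - B' 0))
    (hk : 0 ≤ (A' 0 - A 0) * (B' 1 - A 1) - (A' 1 - A 1) * (B' 0 - A 0))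
    (d1 : dist A B ≤ dist A' B) (d2 : dist A B ≤ dist A B')
    (d3 : dist A' Z ≤ dist O Z) (d4 : dist O B' ≤ dist O Z) : False := by
  rw [dist_le_dist_iff_coord] at d1 d2 d3 d4
  obtain ⟨e1, he1⟩ : ∃ t, t = A' 0 - A 0 := ⟨_, rfl⟩
  obtain ⟨e2, he2⟩ : ∃ t, t = A' 1 - A 1 := ⟨_, rfl⟩
  obtain ⟨f1, hf1⟩ : ∃ t, t = B 0 - B' 0 := ⟨_, rfl⟩
  obtain ⟨f2, hf2⟩ : ∃ t, t = B 1 - B' 1 := ⟨_, rfl⟩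
  obtain ⟨w1, hw1⟩ : ∃ t, t = A 0 - O 0 := ⟨_, rfl⟩
  obtain ⟨w2, hw2⟩ : ∃ t, t = A 1 - O 1 := ⟨_, rfl⟩
  obtain ⟨z1, hz1⟩ : ∃ t, t = Z 0 - B 0 := ⟨_, rfl⟩
  obtain ⟨z2, hz2⟩ : ∃ t, t = Z 1 - B 1 := ⟨_, rfl⟩
  obtain ⟨g1, hg1⟩ : ∃ t, t = B 0 - A 0 := ⟨_, rfl⟩
  obtain ⟨g2, hg2⟩ : ∃ t, t = B 1 - A 1 := ⟨_, rfl⟩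
  have k1 : B 0 - A' 0 = g1 - e1 := by rw [hg1, he1]; ring
  have k2 : B 1 - A' 1 = g2 - e2 := by rw [hg2, he2]; ring
  have k3 : B' 0 - A 0 = g1 - f1 := by rw [hg1, hf1]; ring
  have k4 : B' 1 - A 1 = g2 - f2 := by rw [hg2, hf2]; ring
  have c1 : A 0 - B 0 = - g1 := by rw [hg1]; ring
  have c2 : A 1 - B 1 = - g2 := by rw [hg2]; ring
  have c3 : A' 0 - B 0 = e1 - g1 := by rw [hg1, he1]; ring
  have c4 : A' 1 - B 1 = e2 - g2 := by rw [hg2, he2]; ring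
  have c5 : A 0 - B' 0 = f1 - g1 := by rw [hg1, hf1]; ring
  have c6 : A 1 - B' 1 = f2 - g2 := by rw [hg2, hf2]; ring
  have c7 : A' 0 - Z 0 = e1 - g1 - z1 := by rw [hg1, he1, hz1]; ring
  have c8 : A' 1 - Z 1 = e2 - g2 - z2 := by rw [hg2, he2, hz2]; ring
  have c9 : O 0 - Z 0 = - w1 - g1 - z1 := by rw [hg1, hw1, hz1]; ring
  have c10 : O 1 - Z 1 = - w2 - g2 - z2 := by rw [hg2, hw2, hz2]; ring
  have c11 : O 0 - B' 0 = - w1 - g1 + f1 := by rw [hg1, hw1, hf1]; ring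
  have c12 : O 1 - B' 1 = - w2 - g2 + f2 := by rw [hg2, hw2, hf2]; ring
  rw [k1, k2] at hl
  rw [k3, k4] at hk
  rw [c1, c2, c3, c4] at d1
  rw [c1, c2, c5, c6] at d2
  rw [c7, c8, c9, c10] at d3
  rw [c9, c10, c11, c12] at d4
  rw [← he1, ← he2] at hef hwe hez hne hk
  rw [← hf1, ← hf2] at hef hwf hfz hne hl
  rw [← hw1, ← hw2] at hwf hwe hne
  rw [← hz1, ← hz2] at hez hfz hne
  exact stuck_vectors_false hef hwf hwe hez hfz hne hl hk d1 d2 d3 d4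

/-! ### Convex arcs spanned by a diameter -/

theorem cross_pos_of_half_plane {u1 u2 v1 v2 w1 w2 d1 d2 : ℝ} (hu : 0 < u1 * d1 + u2 * d2)
    (hv : 0 < v1 * d1 + v2 * d2) (hw : 0 < w1 * d1 + w2 * d2) (huv : 0 < u1 * v2 - u2 * v1)
    (hvw : 0 < v1 * w2 - v2 * w1) : 0 < u1 * w2 - u2 * w1 := by
  have h : (u1 * w2 - u2 * w1) * (v1 * d1 + v2 * d2) =
      (u1 * v2 - u2 * v1) * (w1 * d1 + w2 * d2) + (v1 * w2 - v2 * w1) * (u1 * d1 + u2 * d2) := by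
    ring
  have : 0 < (u1 * w2 - u2 * w1) * (v1 * d1 + v2 * d2) := by rw [h]; positivity
  exact pos_of_mul_pos_left this hv.le

theorem dot_pos_of_sq_sub_le {w1 w2 d1 d2 : ℝ} (h : (w1 - d1) ^ 2 + (w2 - d2) ^ 2 ≤ d1 ^ 2 + d2 ^ 2)
    (hne : w1 * d2 - w2 * d1 ≠ 0) : 0 < w1 * d1 + w2 * d2 := by
  have hw : 0 < w1 ^ 2 + w2 ^ 2 := by
    refine lt_of_le_of_ne (by positivity) fun h0 => hne ?_
    have h1 : w1 = 0 := by nlinarith [sq_nonneg w1, sq_nonneg w2]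
    have h2 : w2 = 0 := by nlinarith [sq_nonneg w1, sq_nonneg w2]
    simp [h1, h2]
  linarith

/-- The vector `v` is a positive combination of `u` and `w`: `(u × w) v = (v × w) u + (u × v) w`. -/
theorem dot_pos_of_cone {u1 u2 v1 v2 w1 w2 d1 d2 : ℝ} (hu : 0 < u1 * d1 + u2 * d2)
    (hw : 0 < w1 * d1 + w2 * d2) (hud : 0 < u1 * d2 - u2 * d1) (hdw : 0 < d1 * w2 - d2 * w1)
    (huv : 0 < u1 * v2 - u2 * v1) (hvw : 0 < v1 * w2 - v2 * w1) : 0 < v1 * d1 + v2 * d2 := by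
  have hD : 0 < d1 * d1 + d2 * d2 := by
    refine lt_of_le_of_ne (by nlinarith [sq_nonneg d1, sq_nonneg d2]) fun h0 => ?_
    have h1 : d1 = 0 := by nlinarith [sq_nonneg d1, sq_nonneg d2]
    have h2 : d2 = 0 := by nlinarith [sq_nonneg d1, sq_nonneg d2]
    simp [h1, h2] at hud
  have huw := cross_pos_of_half_plane hu hD hw hud hdw
  have h : (u1 * w2 - u2 * w1) * (v1 * d1 + v2 * d2) =
      (v1 * w2 - v2 * w1) * (u1 * d1 + u2 * d2) + (u1 * v2 - u2 * v1) * (w1 * d1 + w2 * d2) := by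
    ring
  have : 0 < (u1 * w2 - u2 * w1) * (v1 * d1 + v2 * d2) := by rw [h]; positivity
  exact pos_of_mul_pos_right this huw.le

/-- `P 0, …, P K` is a strictly convex arc, traversed counterclockwise, whose end points realise
its diameter. -/
structure IsDiamArc (P : ℕ → EuclideanSpace ℝ (Fin 2)) (K : ℕ) : Prop where
  orient_pos : ∀ i j l, i < j → j < l → l ≤ K → 0 < orient (P i) (P j) (P l)
  dist_le : ∀ i j, i ≤ K → j ≤ K → dist (P i) (P j) ≤ dist (P 0) (P K)

namespace IsDiamArc

variable {P : ℕ → EuclideanSpace ℝ (Fin 2)} {K : ℕ}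

theorem dot_pos_left (h : IsDiamArc P K) {i : ℕ} (hi : 0 < i) (hiK : i < K) :
    0 < (P i 0 - P 0 0) * (P K 0 - P 0 0) + (P i 1 - P 0 1) * (P K 1 - P 0 1) := by
  have h1 := h.dist_le i K hiK.le le_rfl
  rw [dist_le_dist_iff_coord] at h1
  have h2 := h.orient_pos 0 i K hi hiK le_rfl
  unfold orient at h2
  exact dot_pos_of_sq_sub_le (by linarith) h2.ne'

theorem dot_pos_right (h : IsDiamArc P K) {j : ℕ} (hj : 0 < j) (hjK : j < K) :
    0 < (P K 0 - P j 0) * (P K 0 - P 0 0) + (P K 1 - P j 1) * (P K 1 - P 0 1) := by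
  have h1 := h.dist_le 0 j (Nat.zero_le _) hjK.le
  rw [dist_le_dist_iff_coord] at h1
  have h2 := h.orient_pos 0 j K hj hjK le_rfl
  unfold orient at h2
  exact dot_pos_of_sq_sub_le (by linarith) (by intro h0; linarith)

/-- The arc advances monotonically in the direction of its diameter. This puts all chord directions
in one open half-plane, where the sign of the cross product is transitive. -/
theorem dot_pos (h : IsDiamArc P K) (hK : 2 ≤ K) {i j : ℕ} (hij : i < j) (hjK : j ≤ K) :
    0 < (P j 0 - P i 0) * (P K 0 - P 0 0) + (P j 1 - P i 1) * (P K 1 - P 0 1) := by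
  rcases Nat.eq_zero_or_pos i with rfl | hi
  · rcases hjK.lt_or_eq with hjK | rfl
    · exact h.dot_pos_left hij hjK
    · have h1 := h.dot_pos_left (i := 1) (by omega) (by omega)
      have h2 := h.dot_pos_right (j := 1) (by omega) (by omega)
      linarith
  · rcases hjK.lt_or_eq with hjK | rfl
    · have hu := h.dot_pos_left hi (hij.trans hjK)
      have hw := h.dot_pos_right (hi.trans hij) hjK
      have h1 := h.orient_pos 0 i K hi (hij.trans hjK) le_rfl
      have h2 := h.orient_pos 0 j K (hi.trans hij) hjK le_rfl
      have h3 := h.orient_pos 0 i j hi hij hjK.le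
      have h4 := h.orient_pos i j K hij hjK le_rfl
      unfold orient at h1 h2 h3 h4
      exact dot_pos_of_cone hu hw (by linarith) (by linarith) (by linarith) (by linarith)
    · exact h.dot_pos_right hi hij

theorem cross_pos (h : IsDiamArc P K) {i j k l : ℕ} (hij : i < j) (hjk : j ≤ k) (hkl : k < l)
    (hl : l ≤ K) :
    0 < (P j 0 - P i 0) * (P l 1 - P k 1) - (P j 1 - P i 1) * (P l 0 - P k 0) := by
  rcases hjk.eq_or_lt with rfl | hjk
  · have h1 := h.orient_pos i j l hij hkl hl
    unfold orient at h1
    linarith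
  · have h1 := h.orient_pos i j k hij hjk (by omega)
    have h2 := h.orient_pos j k l hjk hkl hl
    unfold orient at h1 h2
    exact cross_pos_of_half_plane (h.dot_pos (by omega) hij (by omega))
      (h.dot_pos (by omega) hjk (by omega)) (h.dot_pos (by omega) hkl hl)
      (by linarith) (by linarith)

theorem cross_nonneg (h : IsDiamArc P K) {i j k l : ℕ} (hij : i ≤ j) (hjk : j ≤ k) (hkl : k ≤ l)
    (hl : l ≤ K) :
    0 ≤ (P j 0 - P i 0) * (P l 1 - P k 1) - (P j 1 - P i 1) * (P l 0 - P k 0) := by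
  rcases hij.eq_or_lt with rfl | hij
  · simp
  rcases hkl.eq_or_lt with rfl | hkl
  · simp
  exact (h.cross_pos hij hjk hkl hl).le

/-- Every chord of the arc other than the diameter gets strictly shorter when one of its end points
is moved inwards. -/
theorem exists_shorter (h : IsDiamArc P K) {a b : ℕ} (hab : a + 1 < b) (hb : b ≤ K)
    (hne : 0 < a ∨ b < K) :
    dist (P (a + 1)) (P b) < dist (P a) (P b) ∨ dist (P a) (P (b - 1)) < dist (P a) (P b) := by
  by_contra! hcon
  obtain ⟨d1, d2⟩ := hcon
  have hl := h.cross_nonneg (i := a + 1) (j := b - 1) (k := b - 1) (l := b) (by omega) le_rfl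
    (by omega) hb
  have hk := h.cross_nonneg (i := a) (j := a + 1) (k := a + 1) (l := b - 1) (by omega) le_rfl
    (by omega) (by omega)
  refine stuck_configuration_false (O := P 0) (A := P a) (A' := P (a + 1)) (B' := P (b - 1))
    (B := P b) (Z := P K) (h.cross_pos (by omega) (by omega) (by omega) hb)
    (h.cross_nonneg (by omega) (by omega) (by omega) hb)
    (h.cross_nonneg (by omega) (by omega) (by omega) (by omega))
    (h.cross_nonneg (by omega) (by omega) (by omega) (by omega))
    (h.cross_nonneg (by omega) (by omega) (by omega) (by omega)) ?_ (by linarith) (by linarith)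
    d1 d2 (h.dist_le _ _ (by omega) le_rfl) (h.dist_le _ _ (by omega) (by omega))
  rcases hne with h0 | h0
  · exact Or.inl (h.cross_pos h0 le_rfl (by omega) (by omega))
  · exact Or.inr (h.cross_pos (by omega) le_rfl h0 le_rfl)

/-- A chord of span `k` of the arc, other than the diameter, is at least as long as `k` distinct
distances. -/
theorem span_le_card (h : IsDiamArc P K) {S : Finset ℝ}
    (hS : ∀ i j, i < j → j ≤ K → dist (P i) (P j) ∈ S) {a b : ℕ} (hab : a < b) (hb : b ≤ K)
    (hne : 0 < a ∨ b < K) :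
    b - a ≤ (S.filter (· ≤ dist (P a) (P b))).card := by
  obtain ⟨k, hk⟩ : ∃ k, b = a + 1 + k := ⟨b - a - 1, by omega⟩
  induction k generalizing a b with
  | zero =>
    have : 0 < (S.filter (· ≤ dist (P a) (P b))).card :=
      Finset.card_pos.2 ⟨_, Finset.mem_filter.2 ⟨hS a b hab hb, le_rfl⟩⟩
    omega
  | succ k ih =>
    -- Passing to a strictly shorter length loses at least the distance of the chord itself.
    have key : ∀ x, x < dist (P a) (P b) →
        (S.filter (· ≤ x)).card < (S.filter (· ≤ dist (P a) (P b))).card := by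
      intro x hx
      refine Finset.card_lt_card ⟨fun y hy => ?_, fun hsub => ?_⟩
      · rw [Finset.mem_filter] at hy ⊢
        exact ⟨hy.1, hy.2.trans hx.le⟩
      · have := hsub (Finset.mem_filter.2 ⟨hS a b hab hb, le_rfl⟩)
        rw [Finset.mem_filter] at this
        exact absurd this.2 (not_le.2 hx)
    rcases h.exists_shorter (by omega) hb hne with h1 | h1
    · have h2 := ih (a := a + 1) (b := b) (by omega) hb (by omega) (by omega)
      have h3 := key _ h1
      omega
    · have h2 := ih (a := a) (b := b - 1) (by omega) (by omega) (by omega) (by omega)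
      have h3 := key _ h1
      omega

end IsDiamArc

/-! ### Convex polygons with few distances -/

/-- `V 0, …, V (n - 1)` are the vertices of a strictly convex polygon in counterclockwise order,
and `V` is extended periodically. -/
structure IsConvexCycle (V : ℕ → EuclideanSpace ℝ (Fin 2)) (n : ℕ) : Prop where
  periodic : ∀ i, V (i + n) = V i
  orient_pos : ∀ i j l, i < j → j < l → l < i + n → 0 < orient (V i) (V j) (V l)

namespace IsConvexCycle

variable {V : ℕ → EuclideanSpace ℝ (Fin 2)} {n : ℕ}

theorem periodic_mul (h : IsConvexCycle V n) (i c : ℕ) : V (i + n * c) = V i := by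
  induction c with
  | zero => simp
  | succ c ih => rw [Nat.mul_succ, ← add_assoc, h.periodic, ih]

theorem mod (h : IsConvexCycle V n) (i : ℕ) : V (i % n) = V i := by
  conv_rhs => rw [← Nat.mod_add_div i n]
  rw [h.periodic_mul]

theorem shift (h : IsConvexCycle V n) (c : ℕ) : IsConvexCycle (fun i => V (c + i)) n where
  periodic i := by rw [← add_assoc, h.periodic]
  orient_pos i j l hij hjl hl := h.orient_pos _ _ _ (by omega) (by omega) (by omega)

theorem ne (h : IsConvexCycle V n) (hn : 3 ≤ n) {i j : ℕ} (hij : i < j) (hj : j < i + n) :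
    V i ≠ V j := by
  intro heq
  by_cases h1 : j = i + 1
  · have := h.orient_pos i j (j + 1) hij (by omega) (by omega)
    simp [orient, heq] at this
  · have := h.orient_pos i (i + 1) j (by omega) (by omega) hj
    simp [orient, heq] at this

theorem exists_max (h : IsConvexCycle V n) (hn : 2 ≤ n) :
    ∃ i K, 0 < K ∧ K < n ∧ ∀ a b, dist (V a) (V b) ≤ dist (V i) (V (i + K)) := by
  obtain ⟨⟨a, b⟩, hab, hmax⟩ := Finset.exists_max_image (Finset.range n ×ˢ Finset.range n)
    (fun x => dist (V x.1) (V x.2)) ⟨(0, 0), by simp; omega⟩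
  have hmax' : ∀ c d, dist (V c) (V d) ≤ dist (V a) (V b) := by
    intro c d
    have := hmax (c % n, d % n) (by simp [Nat.mod_lt _ (show 0 < n by omega)])
    simpa [h.mod] using this
  simp only [Finset.mem_product, Finset.mem_range] at hab
  rcases lt_trichotomy a b with hlt | rfl | hlt
  · refine ⟨a, b - a, by omega, by omega, ?_⟩
    rwa [show a + (b - a) = b by omega]
  · refine ⟨0, 1, one_pos, by omega, fun c d => (hmax' c d).trans ?_⟩
    rw [dist_self]
    exact dist_nonneg
  · refine ⟨b, a - b, by omega, by omega, ?_⟩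
    rw [show b + (a - b) = a by omega, dist_comm (V b)]
    exact hmax'

theorem isDiamArc (h : IsConvexCycle V n) {i K : ℕ} (hK : K < n)
    (hmax : ∀ a b, dist (V a) (V b) ≤ dist (V i) (V (i + K))) :
    IsDiamArc (fun t => V (i + t)) K where
  orient_pos a b c hab hbc hc := h.orient_pos _ _ _ (by omega) (by omega) (by omega)
  dist_le a b _ _ := hmax _ _

/-- The chord with the same end points as the chord of span `K` from `i`, seen from the other
side. -/
theorem max_swap (h : IsConvexCycle V n) {i K : ℕ} (hK : K < n)
    (hmax : ∀ a b, dist (V a) (V b) ≤ dist (V i) (V (i + K))) :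
    ∀ a b, dist (V a) (V b) ≤ dist (V (i + K)) (V (i + K + (n - K))) := by
  intro a b
  rw [show i + K + (n - K) = i + n by omega, h.periodic, dist_comm (V (i + K))]
  exact hmax a b

variable {S : Finset ℝ}

theorem filter_card_ge (h : IsConvexCycle V n)
    (hS : ∀ i j, i < j → j < i + n → dist (V i) (V j) ∈ S) {i L : ℕ} (hL : 0 < L) (hLn : L + 1 < n)
    (hmax : ∀ a b, dist (V a) (V b) ≤ dist (V i) (V (i + (L + 1)))) :
    L ≤ (S.filter (· ≤ dist (V i) (V (i + L)))).card ∧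
      L ≤ (S.filter (· ≤ dist (V (i + 1)) (V (i + (L + 1))))).card := by
  have harc := h.isDiamArc hLn hmax
  have hS' : ∀ a b, a < b → b ≤ L + 1 → dist (V (i + a)) (V (i + b)) ∈ S := fun a b hab hb =>
    hS _ _ (by omega) (by omega)
  have h1 := harc.span_le_card hS' (a := 0) (b := L) hL (by omega) (by omega)
  have h2 := harc.span_le_card hS' (a := 1) (b := L + 1) (by omega) le_rfl (by omega)
  exact ⟨by simpa using h1, by simpa using h2⟩

theorem le_card_of_max (h : IsConvexCycle V n)
    (hS : ∀ i j, i < j → j < i + n → dist (V i) (V j) ∈ S) {i L : ℕ} (hL : 0 < L) (hLn : L + 1 < n)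
    (hmax : ∀ a b, dist (V a) (V b) ≤ dist (V i) (V (i + (L + 1)))) : L ≤ S.card :=
  (h.filter_card_ge hS hL hLn hmax).1.trans (Finset.card_filter_le _ _)

/-- Equality case of the count: the chord dominates `L` distances and there are no more, so it
dominates all of them. Shortening a diameter of span `L + 1` at either end thus gives another
diameter. -/
theorem max_step (h : IsConvexCycle V n)
    (hS : ∀ i j, i < j → j < i + n → dist (V i) (V j) ∈ S) {i L : ℕ} (hL : 0 < L) (hLn : L + 1 < n)
    (hcard : S.card ≤ L)
    (hmax : ∀ a b, dist (V a) (V b) ≤ dist (V i) (V (i + (L + 1)))) :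
    (∀ s ∈ S, s ≤ dist (V i) (V (i + L))) ∧
      (∀ s ∈ S, s ≤ dist (V (i + 1)) (V (i + (L + 1)))) := by
  obtain ⟨h1, h2⟩ := h.filter_card_ge hS hL hLn hmax
  exact ⟨Finset.card_filter_eq_iff.1 (le_antisymm (Finset.card_filter_le _ _) (hcard.trans h1)),
    Finset.card_filter_eq_iff.1 (le_antisymm (Finset.card_filter_le _ _) (hcard.trans h2))⟩

theorem max_of_top (hS : ∀ i j, i < j → j < i + n → dist (V i) (V j) ∈ S) {i K : ℕ} (hK : 0 < K)
    (hKn : K < n) (hmax : ∀ a b, dist (V a) (V b) ≤ dist (V i) (V (i + K))) {x : ℝ}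
    (hx : ∀ s ∈ S, s ≤ x) : ∀ a b, dist (V a) (V b) ≤ x := fun a b =>
  (hmax a b).trans (hx _ (hS _ _ (by omega) (by omega)))

/-- A strictly convex `(2m+1)`-gon has at least `m` distances. -/
theorem le_card_odd {m : ℕ} (h : IsConvexCycle V (2 * m + 1)) (hm : 0 < m)
    (hS : ∀ i j, i < j → j < i + (2 * m + 1) → dist (V i) (V j) ∈ S) : m ≤ S.card := by
  obtain ⟨i, K, hK0, hK, hmax⟩ := h.exists_max (by omega)
  -- One of the two arcs between the ends of the diameter has span at least `m + 1`.
  by_cases hKm : m + 1 ≤ K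
  · obtain ⟨L, rfl⟩ : ∃ L, K = L + 1 := ⟨K - 1, by omega⟩
    have := h.le_card_of_max hS (by omega) hK hmax
    omega
  · have hmax' := h.max_swap hK hmax
    obtain ⟨L, hL⟩ : ∃ L, 2 * m + 1 - K = L + 1 := ⟨2 * m - K, by omega⟩
    rw [hL] at hmax'
    have := h.le_card_of_max hS (by omega) (by omega) hmax'
    omega

/-- If a strictly convex `(2m+1)`-gon has at most `m` distances, then all its chords of span `m`
and `m + 1` have the largest length. -/
theorem main_diagonals_of_odd {m : ℕ} (h : IsConvexCycle V (2 * m + 1)) (hm : 0 < m)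
    (hS : ∀ i j, i < j → j < i + (2 * m + 1) → dist (V i) (V j) ∈ S) (hcard : S.card ≤ m) (i : ℕ) :
    (∀ s ∈ S, s ≤ dist (V i) (V (i + m))) ∧ (∀ s ∈ S, s ≤ dist (V i) (V (i + (m + 1)))) := by
  have init : ∃ i, ∀ a b, dist (V a) (V b) ≤ dist (V i) (V (i + (m + 1))) := by
    obtain ⟨i, K, hK0, hK, hmax⟩ := h.exists_max (by omega)
    by_cases hKm : m + 1 ≤ K
    · obtain ⟨L, rfl⟩ : ∃ L, K = L + 1 := ⟨K - 1, by omega⟩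
      have := h.le_card_of_max hS (by omega) hK hmax
      obtain rfl : L = m := by omega
      exact ⟨i, hmax⟩
    · have hmax' := h.max_swap hK hmax
      obtain ⟨L, hL⟩ : ∃ L, 2 * m + 1 - K = L + 1 := ⟨2 * m - K, by omega⟩
      rw [hL] at hmax'
      have := h.le_card_of_max hS (by omega) (by omega) hmax'
      obtain rfl : L = m := by omega
      exact ⟨_, hmax'⟩
  -- Seen from the other side, the chord of span `m` from `i + 1` has span `m + 1` and starts at `i
  -- + (m + 1)`.
  have half : ∀ i, (∀ a b, dist (V a) (V b) ≤ dist (V i) (V (i + (m + 1)))) →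
      ∀ a b, dist (V a) (V b) ≤ dist (V (i + (m + 1))) (V (i + (m + 1) + (m + 1))) := by
    intro i hi
    have h1 := max_of_top hS (by omega) (by omega) hi
      (h.max_step hS hm (by omega) hcard hi).2
    rw [show i + (m + 1) + (m + 1) = i + 1 + (2 * m + 1) by ring, h.periodic,
      dist_comm (V (i + (m + 1)))]
    exact h1
  have step : ∀ i, (∀ a b, dist (V a) (V b) ≤ dist (V i) (V (i + (m + 1)))) →
      ∀ a b, dist (V a) (V b) ≤ dist (V (i + 1)) (V (i + 1 + (m + 1))) := by
    intro i hi
    -- Two moves by `m + 1` amount to one step forward modulo `2m + 1`.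
    have h1 := half _ (half _ hi)
    rw [show i + (m + 1) + (m + 1) + (m + 1) = i + 1 + (m + 1) + (2 * m + 1) by ring, h.periodic,
      show i + (m + 1) + (m + 1) = i + 1 + (2 * m + 1) by ring, h.periodic] at h1
    exact h1
  have all : ∀ a b, dist (V a) (V b) ≤ dist (V i) (V (i + (m + 1))) := by
    obtain ⟨i0, h0⟩ := init
    have hge : ∀ k, ∀ a b, dist (V a) (V b) ≤ dist (V (i0 + k)) (V (i0 + k + (m + 1))) := by
      intro k
      induction k with
      | zero => exact h0
      | succ k ih => exact step _ ih
    -- Adding the multiple `(2m + 1) * i0` of the period makes the target reachable by forward steps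
    -- from `i0`.
    have h1 := hge (i + (2 * m + 1) * i0 - i0)
    have h2 : i0 ≤ (2 * m + 1) * i0 := Nat.le_mul_of_pos_left _ (by omega)
    rw [show i0 + (i + (2 * m + 1) * i0 - i0) = i + (2 * m + 1) * i0 by omega,
      show i + (2 * m + 1) * i0 + (m + 1) = i + (m + 1) + (2 * m + 1) * i0 by ring,
      h.periodic_mul, h.periodic_mul] at h1
    exact h1
  have h1 := (h.max_step hS hm (by omega) hcard all).1
  exact ⟨h1, fun s hs => (h1 s hs).trans (all _ _)⟩

/-- A strictly convex `2m`-gon has at least `m` distances. -/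
theorem le_card_even {m : ℕ} (h : IsConvexCycle V (2 * m)) (hm : 2 ≤ m)
    (hS : ∀ i j, i < j → j < i + 2 * m → dist (V i) (V j) ∈ S) : m ≤ S.card := by
  have large : ∀ i K, m < K → K < 2 * m →
      (∀ a b, dist (V a) (V b) ≤ dist (V i) (V (i + K))) → m ≤ S.card := by
    intro i K hK hK2 hmax
    obtain ⟨L, rfl⟩ : ∃ L, K = L + 1 := ⟨K - 1, by omega⟩
    have := h.le_card_of_max hS (by omega) hK2 hmax
    omega
  obtain ⟨i, K, hK0, hK, hmax⟩ := h.exists_max (by omega)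
  rcases lt_trichotomy K m with hlt | rfl | hlt
  · exact large _ _ (by omega) (by omega) (h.max_swap hK hmax)
  · by_contra hcon
    obtain ⟨L, rfl⟩ : ∃ L, K = L + 1 := ⟨K - 1, by omega⟩
    -- With fewer than `m` distances a diameter of span `m` shortens to one of span `m - 1`, whose
    -- complementary span `m + 1` is already excluded.
    have h1 := max_of_top hS hK0 hK hmax
      (h.max_step hS (by omega) (by omega) (by omega) hmax).1
    exact hcon (large _ _ (by omega) (by omega) (h.max_swap (by omega) h1))
  · exact large _ _ hlt hK hmax

/-- If a strictly convex `2m`-gon with at most `m` distances has a unique diameter, then the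
diameter is a main diagonal. -/
theorem diam_span_even {m : ℕ} (h : IsConvexCycle V (2 * m)) (hm : 2 ≤ m)
    (hS : ∀ i j, i < j → j < i + 2 * m → dist (V i) (V j) ∈ S) (hcard : S.card ≤ m)
    {K : ℕ} (hK0 : 0 < K) (hK : K < 2 * m)
    (hlt : ∀ i j, i < j → j < 2 * m → (i ≠ 0 ∨ j ≠ K) → dist (V i) (V j) < dist (V 0) (V K)) :
    K = m := by
  -- If the shortened chord is no longer a diameter, the diameter is an extra distance beyond the
  -- `L` it dominates. Applied on both sides, this bounds both spans by `m`.
  have hdef : ∀ L, 0 < L → L + 1 < 2 * m → ∀ i,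
      (∀ a b, dist (V a) (V b) ≤ dist (V i) (V (i + (L + 1)))) →
      dist (V i) (V (i + L)) < dist (V i) (V (i + (L + 1))) → L < m := by
    intro L hL hL2 i hmax hlt'
    have h1 := (h.filter_card_ge hS hL hL2 hmax).1
    refine lt_of_lt_of_le (lt_of_le_of_lt h1 (Finset.card_lt_card ?_)) hcard
    refine Finset.filter_ssubset.2 ⟨_, hS i (i + (L + 1)) (by omega) (by omega), not_le.2 hlt'⟩
  have hmax : ∀ a b, dist (V a) (V b) ≤ dist (V 0) (V (0 + K)) := by
    rw [zero_add]
    have hmax' : ∀ a b, a < b → b < 2 * m → dist (V a) (V b) ≤ dist (V 0) (V K) := by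
      intro a b hab hb
      by_cases hc : a ≠ 0 ∨ b ≠ K
      · exact (hlt a b hab hb hc).le
      · push Not at hc
        rw [hc.1, hc.2]
    intro a b
    rw [← h.mod a, ← h.mod b]
    have ha := Nat.mod_lt a (show 0 < 2 * m by omega)
    have hb := Nat.mod_lt b (show 0 < 2 * m by omega)
    rcases lt_trichotomy (a % (2 * m)) (b % (2 * m)) with h1 | h1 | h1
    · exact hmax' _ _ h1 hb
    · rw [h1, dist_self]; exact dist_nonneg
    · rw [dist_comm]; exact hmax' _ _ h1 ha
  rcases lt_trichotomy K m with hKm | rfl | hKm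
  · exfalso
    have h1 := h.max_swap hK hmax
    obtain ⟨L, hL⟩ : ∃ L, 2 * m - K = L + 1 := ⟨2 * m - K - 1, by omega⟩
    rw [hL] at h1
    have := hdef L (by omega) (by omega) _ h1 (by
      rw [show 0 + K + (L + 1) = 0 + 2 * m by omega, h.periodic, dist_comm _ (V 0), zero_add]
      exact hlt K (K + L) (by omega) (by omega) (by omega))
    omega
  · rfl
  · exfalso
    obtain ⟨L, rfl⟩ : ∃ L, K = L + 1 := ⟨K - 1, by omega⟩
    have := hdef L (by omega) (by omega) _ hmax (by
      simp only [zero_add]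
      exact hlt 0 L (by omega) (by omega) (by omega))
    omega

end IsConvexCycle

/-! ### From convex position to a cyclic order -/

/-- A strictly convex list of `n` points closes up to a convex cycle. -/
theorem isConvexCycle_of_orient_pos {v : ℕ → EuclideanSpace ℝ (Fin 2)} {n : ℕ} (hn : 0 < n)
    (h : ∀ i j l, i < j → j < l → l < n → 0 < orient (v i) (v j) (v l)) :
    IsConvexCycle (fun i => v (i % n)) n where
  periodic i := by simp
  orient_pos i j l hij hjl hl := by
    have hcyc : ∀ p q r : EuclideanSpace ℝ (Fin 2), orient p q r = orient q r p := by
      intro p q r; unfold orient; ring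
    have hi := Nat.mod_lt i hn
    have hred : ∀ k, i ≤ k → k < i + n → (i % n + (k - i) < n ∧ k % n = i % n + (k - i)) ∨
        (n ≤ i % n + (k - i) ∧ k % n = i % n + (k - i) - n) := by
      intro k hik hk
      have hk' : k % n = (i % n + (k - i)) % n := by
        rw [Nat.mod_add_mod, show i + (k - i) = k by omega]
      rcases lt_or_ge (i % n + (k - i)) n with hlt | hge
      · exact Or.inl ⟨hlt, by rw [hk', Nat.mod_eq_of_lt hlt]⟩
      · refine Or.inr ⟨hge, ?_⟩
        rw [hk', Nat.mod_eq_sub_mod hge, Nat.mod_eq_of_lt (by omega)]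
    -- Reduction modulo `n` only rotates the triple cyclically; `l` wraps around whenever `j` does.
    rcases hred j (by omega) (by omega) with ⟨j1, j2⟩ | ⟨j1, j2⟩ <;>
    rcases hred l (by omega) (by omega) with ⟨l1, l2⟩ | ⟨l1, l2⟩
    · exact h _ _ _ (by omega) (by omega) (by omega)
    · rw [← hcyc (v (l % n))]
      exact h _ _ _ (by omega) (by omega) (by omega)
    · omega
    · rw [hcyc]
      exact h _ _ _ (by omega) (by omega) (by omega)

section ConvexPosition

variable {X : Finset (EuclideanSpace ℝ (Fin 2))}

theorem InConvexPosition.not_combination (h : InConvexPosition X)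
    {x a b c : EuclideanSpace ℝ (Fin 2)} (hx : x ∈ X) (ha : a ∈ X) (hb : b ∈ X) (hc : c ∈ X)
    (hax : a ≠ x) (hbx : b ≠ x) (hcx : c ≠ x) {r s t : ℝ} (hr : 0 ≤ r) (hs : 0 ≤ s) (ht : 0 ≤ t)
    (hpos : 0 < r + s + t)
    (h0 : r * (a 0 - x 0) + s * (b 0 - x 0) + t * (c 0 - x 0) = 0)
    (h1 : r * (a 1 - x 1) + s * (b 1 - x 1) + t * (c 1 - x 1) = 0) : False := by
  have hX := convexIndependent_set_iff_notMem_convexHull_sdiff.1 h x hx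
  apply hX
  have hmem := (convex_convexHull ℝ ((X : Set (EuclideanSpace ℝ (Fin 2))) \ {x})).sum_mem
    (t := Finset.univ) (w := ![r / (r + s + t), s / (r + s + t), t / (r + s + t)])
    (z := ![a, b, c]) (by
      intro i _
      fin_cases i
      · exact div_nonneg hr hpos.le
      · exact div_nonneg hs hpos.le
      · exact div_nonneg ht hpos.le) (by
      simp only [Fin.sum_univ_three]
      change r / (r + s + t) + s / (r + s + t) + t / (r + s + t) = 1
      field_simp) (by
      intro i _
      apply subset_convexHull
      fin_cases i
      · exact ⟨ha, hax⟩
      · exact ⟨hb, hbx⟩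
      · exact ⟨hc, hcx⟩)
  convert hmem using 1
  simp only [Fin.sum_univ_three]
  change x = (r / (r + s + t)) • a + (s / (r + s + t)) • b + (t / (r + s + t)) • c
  ext i
  fin_cases i
  · simp only [Fin.zero_eta, PiLp.add_apply, PiLp.smul_apply, smul_eq_mul]
    field_simp
    linarith
  · simp only [Fin.mk_one, PiLp.add_apply, PiLp.smul_apply, smul_eq_mul]
    field_simp
    linarith

/-- Of three collinear points one lies between the other two; the parameter `t` of `r` on the line
`p q` decides which. -/
theorem InConvexPosition.orient_ne_zero (h : InConvexPosition X)
    {p q r : EuclideanSpace ℝ (Fin 2)} (hp : p ∈ X) (hq : q ∈ X) (hr : r ∈ X)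
    (hpq : p ≠ q) (hqr : q ≠ r) (hpr : p ≠ r) : orient p q r ≠ 0 := by
  intro h0
  unfold orient at h0
  have hN : 0 < (q 0 - p 0) ^ 2 + (q 1 - p 1) ^ 2 := by
    refine lt_of_le_of_ne (by positivity) fun hN => hpq ?_
    have h1 : q 0 - p 0 = 0 := by nlinarith [sq_nonneg (q 0 - p 0), sq_nonneg (q 1 - p 1)]
    have h2 : q 1 - p 1 = 0 := by nlinarith [sq_nonneg (q 0 - p 0), sq_nonneg (q 1 - p 1)]
    ext i
    fin_cases i
    · simp; linarith
    · simp; linarith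
  obtain ⟨t, ht⟩ : ∃ t, t = ((r 0 - p 0) * (q 0 - p 0) + (r 1 - p 1) * (q 1 - p 1)) /
    ((q 0 - p 0) ^ 2 + (q 1 - p 1) ^ 2) := ⟨_, rfl⟩
  have ht' := (eq_div_iff hN.ne').1 ht
  have e0 : r 0 - p 0 = t * (q 0 - p 0) := by
    apply mul_right_cancel₀ hN.ne'
    linear_combination (p 0 - q 0) * ht' - (q 1 - p 1) * h0
  have e1 : r 1 - p 1 = t * (q 1 - p 1) := by
    apply mul_right_cancel₀ hN.ne'
    linear_combination (p 1 - q 1) * ht' + (q 0 - p 0) * h0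
  rcases le_total t 0 with h1 | h1
  · exact h.not_combination hp hr hq hq hpr.symm hpq.symm hpq.symm (r := 1) (s := -t) (t := 0)
      zero_le_one (by linarith) le_rfl (by linarith) (by linarith) (by linarith)
  rcases le_total t 1 with h2 | h2
  · exact h.not_combination hr hq hp hp hqr hpr hpr (r := t) (s := 1 - t) (t := 0)
      h1 (by linarith) le_rfl (by linarith) (by linarith) (by linarith)
  · exact h.not_combination hq hr hp hp hqr.symm hpq hpq (r := 1) (s := t - 1) (t := 0)
      zero_le_one (by linarith) le_rfl (by linarith) (by linarith) (by linarith)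

/-- The areas of the three subtriangles at `x` are, up to scaling, its barycentric coordinates. -/
theorem InConvexPosition.not_mem_triangle (h : InConvexPosition X)
    {x a b c : EuclideanSpace ℝ (Fin 2)} (hx : x ∈ X) (ha : a ∈ X) (hb : b ∈ X) (hc : c ∈ X)
    (hab : 0 < orient x a b) (hbc : 0 < orient x b c) (hca : 0 < orient x c a) : False := by
  have hax : a ≠ x := by rintro rfl; simp [orient] at hab
  have hbx : b ≠ x := by rintro rfl; simp [orient] at hbc
  have hcx : c ≠ x := by rintro rfl; simp [orient] at hca
  refine h.not_combination hx ha hb hc hax hbx hcx hbc.le hca.le hab.le (by linarith) ?_ ?_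
  · unfold orient; ring
  · unfold orient; ring

theorem orient_swap (p q r : EuclideanSpace ℝ (Fin 2)) : orient p r q = -orient p q r := by
  unfold orient; ring

theorem orient_rotate (p q r : EuclideanSpace ℝ (Fin 2)) : orient q r p = orient p q r := by
  unfold orient; ring

/-- The other points of a set in convex position can be sorted by angle around any of its points. -/
theorem InConvexPosition.isStrictTotalOrder (h : InConvexPosition X)
    {p : EuclideanSpace ℝ (Fin 2)} (hp : p ∈ X) :
    IsStrictTotalOrder {x // x ∈ X.erase p} (fun x y => 0 < orient p x.1 y.1) where
  trichotomous x y h1 h2 := by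
    by_contra hne
    have hx := Finset.mem_erase.1 x.2
    have hy := Finset.mem_erase.1 y.2
    have h3 := h.orient_ne_zero hp hx.2 hy.2 hx.1.symm (fun h => hne (Subtype.ext h)) hy.1.symm
    rw [orient_swap] at h2
    exact h3 (le_antisymm (not_lt.1 h1) (by linarith))
  irrefl x hx := by simp [orient] at hx; linarith
  trans x y z hxy hyz := by
    have hx := Finset.mem_erase.1 x.2
    have hy := Finset.mem_erase.1 y.2
    have hz := Finset.mem_erase.1 z.2
    by_contra hxz
    have hne : x.1 ≠ z.1 := by
      intro hxz'
      rw [← hxz', orient_swap] at hyz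
      linarith
    have h3 := h.orient_ne_zero hp hx.2 hz.2 hx.1.symm hne hz.1.symm
    have h4 : 0 < orient p z.1 x.1 := by
      rw [orient_swap]
      have := lt_of_le_of_ne (not_lt.1 hxz) h3
      linarith
    exact h.not_mem_triangle hp hx.2 hy.2 hz.2 hxy hyz h4

/-- Sort the other points by angle around `p`. A triple without `p` that turned the wrong way would
place its middle point inside the triangle formed by `p` and the outer two. -/
theorem InConvexPosition.exists_orient_pos (h : InConvexPosition X) {n : ℕ} (hn : X.card = n)
    {p : EuclideanSpace ℝ (Fin 2)} (hp : p ∈ X) :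
    ∃ v : ℕ → EuclideanSpace ℝ (Fin 2), v 0 = p ∧ (∀ i, v i ∈ X) ∧ (∀ x ∈ X, ∃ i < n, v i = x) ∧
      ∀ i j l, i < j → j < l → l < n → 0 < orient (v i) (v j) (v l) := by
  classical
  have := h.isStrictTotalOrder hp
  let _ : LinearOrder {x // x ∈ X.erase p} :=
    linearOrderOfSTO (fun x y : {x // x ∈ X.erase p} => 0 < orient p x.1 y.1)
  have hpos : 0 < n := hn ▸ Finset.card_pos.2 ⟨p, hp⟩
  have hcard : Fintype.card {x // x ∈ X.erase p} = n - 1 := by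
    rw [Fintype.card_coe, Finset.card_erase_of_mem hp, hn]
  let e := Fintype.orderIsoFinOfCardEq {x // x ∈ X.erase p} hcard
  have he : ∀ i j : Fin (n - 1), i < j → 0 < orient p (e i).1 (e j).1 := fun i j hij =>
    e.lt_iff_lt.2 hij
  have hX : ∀ i, (e i).1 ∈ X := fun i => Finset.mem_of_mem_erase (e i).2
  let v : ℕ → EuclideanSpace ℝ (Fin 2) := fun i =>
    if hi : i - 1 < n - 1 ∧ 0 < i then (e ⟨i - 1, hi.1⟩).1 else p
  have hv0 : v 0 = p := by simp [v]
  have hv : ∀ i (hi : i < n - 1), v (i + 1) = (e ⟨i, hi⟩).1 := by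
    intro i hi
    simp [v, hi]
  refine ⟨v, hv0, ?_, ?_, ?_⟩
  · intro i
    by_cases hi : i - 1 < n - 1 ∧ 0 < i
    · simp only [v, dif_pos hi]; exact hX _
    · simp only [v, dif_neg hi]; exact hp
  · intro x hx
    by_cases hxp : x = p
    · exact ⟨0, hpos, hv0.trans hxp.symm⟩
    · obtain ⟨i, hi⟩ := e.surjective ⟨x, Finset.mem_erase.2 ⟨hxp, hx⟩⟩
      refine ⟨i.1 + 1, by omega, ?_⟩
      rw [hv i.1 i.2, hi]
  · intro i j l hij hjl hl
    obtain ⟨j, rfl⟩ : ∃ j', j = j' + 1 := ⟨j - 1, by omega⟩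
    obtain ⟨l, rfl⟩ : ∃ l', l = l' + 1 := ⟨l - 1, by omega⟩
    rw [hv j (by omega), hv l (by omega)]
    have hjl' := he ⟨j, by omega⟩ ⟨l, by omega⟩ (by simpa using hjl)
    rcases Nat.eq_zero_or_pos i with rfl | hi
    · rw [hv0]; exact hjl'
    obtain ⟨i, rfl⟩ : ∃ i', i = i' + 1 := ⟨i - 1, by omega⟩
    rw [hv i (by omega)]
    have hij' := he ⟨i, by omega⟩ ⟨j, by omega⟩ (by simpa using hij)
    have hil' := he ⟨i, by omega⟩ ⟨l, by omega⟩ (Fin.mk_lt_mk.2 (by omega))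
    set a := (e ⟨i, by omega⟩).1
    set b := (e ⟨j, by omega⟩).1
    set c := (e ⟨l, by omega⟩).1
    have hab : a ≠ b := by intro hab; rw [hab] at hij'; simp [orient] at hij'; linarith
    have hbc : b ≠ c := by intro hab; rw [hab] at hjl'; simp [orient] at hjl'; linarith
    have hac : a ≠ c := by intro hab; rw [hab] at hil'; simp [orient] at hil'; linarith
    have hne := h.orient_ne_zero (hX ⟨i, by omega⟩) (hX ⟨j, by omega⟩) (hX ⟨l, by omega⟩)
      hab hbc hac
    by_contra hcon
    have hlt : orient a b c < 0 := lt_of_le_of_ne (not_lt.1 hcon) hne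
    refine h.not_mem_triangle (hX ⟨j, by omega⟩) hp (hX ⟨i, by omega⟩) (hX ⟨l, by omega⟩)
      (?_ : 0 < orient b p a) (?_ : 0 < orient b a c) (?_ : 0 < orient b c p)
    · rwa [orient_rotate, orient_rotate]
    · rw [orient_swap, orient_rotate]; linarith
    · rwa [orient_rotate]

/-! ### Counting pairs by distance -/

theorem dist_mem_distanceSet {p q : EuclideanSpace ℝ (Fin 2)} (hp : p ∈ X) (hq : q ∈ X)
    (hpq : p ≠ q) : dist p q ∈ distanceSet X :=
  Finset.mem_image.2 ⟨(p, q), Finset.mem_offDiag.2 ⟨hp, hq, hpq⟩, rfl⟩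

theorem sum_distMultiplicity (X : Finset (EuclideanSpace ℝ (Fin 2))) :
    ∑ d ∈ distanceSet X, distMultiplicity X d = X.card.choose 2 := by
  classical
  rw [← Sym2.card_image_offDiag]
  let f : Sym2 (EuclideanSpace ℝ (Fin 2)) → ℝ := Sym2.lift ⟨dist, dist_comm⟩
  rw [Finset.card_eq_sum_card_fiberwise (f := f) (t := distanceSet X)]
  · refine Finset.sum_congr rfl fun d _ => ?_
    unfold distMultiplicity
    congr 1
    ext e
    simp only [Finset.mem_filter, Finset.mem_image, Finset.mem_offDiag, Prod.exists,
      Function.uncurry]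
    constructor
    · rintro ⟨he, p, q, hpq, rfl, hd⟩
      rw [Finset.mk_mem_sym2_iff] at he
      exact ⟨⟨p, q, ⟨he.1, he.2, hpq⟩, rfl⟩, hd⟩
    · rintro ⟨⟨p, q, ⟨hp, hq, hpq⟩, rfl⟩, hd⟩
      exact ⟨Finset.mk_mem_sym2_iff.2 ⟨hp, hq⟩, p, q, hpq, rfl, hd⟩
  · intro e he
    simp only [Finset.coe_image, Set.mem_image, Finset.mem_coe, Finset.mem_offDiag, Prod.exists,
      Function.uncurry] at he
    obtain ⟨p, q, ⟨hp, hq, hpq⟩, rfl⟩ := he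
    exact dist_mem_distanceSet hp hq hpq

theorem le_distMultiplicity {d : ℝ} {k : ℕ}
    (g : ℕ → EuclideanSpace ℝ (Fin 2) × EuclideanSpace ℝ (Fin 2))
    (hg : ∀ i < k, (g i).1 ∈ X ∧ (g i).2 ∈ X ∧ (g i).1 ≠ (g i).2 ∧ dist (g i).1 (g i).2 = d)
    (hinj : ∀ i j, i < j → j < k → s((g i).1, (g i).2) ≠ s((g j).1, (g j).2)) :
    k ≤ distMultiplicity X d := by
  classical
  unfold distMultiplicity
  conv_lhs => rw [← Finset.card_range k]
  apply Finset.card_le_card_of_injOn (fun i => s((g i).1, (g i).2))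
  · intro i hi
    obtain ⟨h1, h2, h3, h4⟩ := hg i (Finset.mem_range.1 hi)
    exact Finset.mem_coe.2 (Finset.mem_filter.2
      ⟨Finset.mk_mem_sym2_iff.2 ⟨h1, h2⟩, _, _, h3, rfl, h4⟩)
  · intro i hi j hj hij
    have hi' := Finset.mem_range.1 hi
    have hj' := Finset.mem_range.1 hj
    rcases lt_trichotomy i j with h | h | h
    · exact absurd hij (hinj i j h hj')
    · exact h
    · exact absurd hij.symm (hinj j i h hi')

theorem eq_of_distMultiplicity_le_one {d : ℝ} (h : distMultiplicity X d ≤ 1)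
    {p q r s : EuclideanSpace ℝ (Fin 2)} (hp : p ∈ X) (hq : q ∈ X) (hr : r ∈ X) (hs : s ∈ X)
    (hpq : p ≠ q) (hrs : r ≠ s) (h1 : dist p q = d) (h2 : dist r s = d) :
    s(p, q) = s(r, s) := by
  classical
  unfold distMultiplicity at h
  exact Finset.card_le_one.1 h _ (Finset.mem_filter.2
      ⟨Finset.mk_mem_sym2_iff.2 ⟨hp, hq⟩, _, _, hpq, rfl, h1⟩) _ (Finset.mem_filter.2
      ⟨Finset.mk_mem_sym2_iff.2 ⟨hr, hs⟩, _, _, hrs, rfl, h2⟩)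

theorem one_le_distMultiplicity {d : ℝ} (hd : d ∈ distanceSet X) : 1 ≤ distMultiplicity X d := by
  obtain ⟨⟨p, q⟩, hpq, rfl⟩ := Finset.mem_image.1 hd
  obtain ⟨hp, hq, hne⟩ := Finset.mem_offDiag.1 hpq
  refine le_distMultiplicity (fun _ => (p, q)) (fun _ _ => ⟨hp, hq, hne, rfl⟩) ?_
  intro i j hij hj
  omega

theorem card_mul_add_le_choose {k : ℕ} {δ : ℝ} (hδ : δ ∈ distanceSet X)
    (h : ∀ d ∈ distanceSet X, d ≠ δ → k ≤ distMultiplicity X d) :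
    ((distanceSet X).card - 1) * k + distMultiplicity X δ ≤ X.card.choose 2 := by
  rw [← sum_distMultiplicity, ← Finset.sum_erase_add _ _ hδ, ← Finset.card_erase_of_mem hδ]
  refine Nat.add_le_add_right ?_ _
  rw [← smul_eq_mul]
  exact Finset.card_nsmul_le_sum _ _ _ fun d hd =>
    h d (Finset.mem_of_mem_erase hd) (Finset.ne_of_mem_erase hd)

theorem card_mul_add_add_le_choose {k : ℕ} {δ ε : ℝ} (hδ : δ ∈ distanceSet X)
    (hε : ε ∈ distanceSet X) (hne : ε ≠ δ)
    (h : ∀ d ∈ distanceSet X, d ≠ δ → k ≤ distMultiplicity X d) :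
    ((distanceSet X).card - 2) * k + distMultiplicity X ε + distMultiplicity X δ ≤
      X.card.choose 2 := by
  have hε' : ε ∈ (distanceSet X).erase δ := Finset.mem_erase.2 ⟨hne, hε⟩
  rw [← sum_distMultiplicity, ← Finset.sum_erase_add _ _ hδ, ← Finset.sum_erase_add _ _ hε',
    show (distanceSet X).card - 2 = (((distanceSet X).erase δ).erase ε).card by
      rw [Finset.card_erase_of_mem hε', Finset.card_erase_of_mem hδ]; omega]
  refine Nat.add_le_add_right (Nat.add_le_add_right ?_ _) _
  rw [← smul_eq_mul]
  refine Finset.card_nsmul_le_sum _ _ _ fun d hd => ?_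
  have hd' := Finset.mem_of_mem_erase hd
  exact h d (Finset.mem_of_mem_erase hd') (Finset.ne_of_mem_erase hd')

/-! ### The counting contradiction, odd and even -/

namespace IsConvexCycle

variable {V : ℕ → EuclideanSpace ℝ (Fin 2)} {n : ℕ}

/-- Below `2 * n` an index wraps at most once, which reduces equality of chords to linear arithmetic
on indices. -/
theorem eq_cases (h : IsConvexCycle V n) (hn : 3 ≤ n) {x y : ℕ} (hx : x < 2 * n) (hy : y < 2 * n)
    (hxy : V x = V y) : x = y ∨ x = y + n ∨ y = x + n := by
  have aux : ∀ x y, x < y → y < 2 * n → V x = V y → y = x + n := by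
    intro x y hlt hy hxy
    by_contra hne
    rcases lt_or_ge y (x + n) with h1 | h1
    · exact h.ne hn hlt h1 hxy
    · refine h.ne hn (i := x) (j := y - n) (by omega) (by omega) ?_
      rw [hxy, ← h.periodic (y - n), show y - n + n = y by omega]
  rcases lt_trichotomy x y with hlt | heq | hlt
  · exact Or.inr (Or.inr (aux x y hlt hy hxy))
  · exact Or.inl heq
  · exact Or.inr (Or.inl (aux y x hlt hx hxy.symm))

/-- If the strictly convex `(2m-1)`-gon obtained from a `2m`-gon by removing a vertex has at most
`m - 1` distances, then its main diagonals have the largest length. -/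
theorem main_diagonals_of_erase {m : ℕ} (h : IsConvexCycle V (2 * (m + 1))) (hm : 0 < m)
    {S : Finset ℝ} (hcard : S.card ≤ m)
    (hS : ∀ a b, 0 < a → a < b → b < 2 * (m + 1) → dist (V a) (V b) ∈ S) :
    (∀ a, 0 < a → a ≤ m + 1 → ∀ s ∈ S, s ≤ dist (V a) (V (a + m))) ∧
      ∀ a, 0 < a → a ≤ m → ∀ s ∈ S, s ≤ dist (V a) (V (a + (m + 1))) := by
  have hW := isConvexCycle_of_orient_pos (v := fun i => V (1 + i)) (n := 2 * m + 1) (by omega)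
    (fun i j l hij hjl hl => h.orient_pos _ _ _ (by omega) (by omega) (by omega))
  have hS' : ∀ i j, i < j → j < i + (2 * m + 1) →
      dist (V (1 + i % (2 * m + 1))) (V (1 + j % (2 * m + 1))) ∈ S := by
    intro i j hij hj
    have hi' := Nat.mod_lt i (show 0 < 2 * m + 1 by omega)
    have hj' := Nat.mod_lt j (show 0 < 2 * m + 1 by omega)
    rcases lt_trichotomy (i % (2 * m + 1)) (j % (2 * m + 1)) with h1 | h1 | h1
    · exact hS _ _ (by omega) (by omega) (by omega)
    · have h2 : j - i = 0 :=
        Nat.eq_zero_of_dvd_of_lt ((Nat.modEq_iff_dvd' hij.le).1 h1) (by omega)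
      omega
    · rw [dist_comm]
      exact hS _ _ (by omega) (by omega) (by omega)
  have key := hW.main_diagonals_of_odd hm hS' hcard
  constructor
  · intro a ha ham s hs
    have := (key (a - 1)).1 s hs
    rwa [Nat.mod_eq_of_lt (by omega), Nat.mod_eq_of_lt (by omega),
      show 1 + (a - 1) = a by omega, show 1 + (a - 1 + m) = a + m by omega] at this
  · intro a ha ham s hs
    have := (key (a - 1)).2 s hs
    rwa [Nat.mod_eq_of_lt (by omega), Nat.mod_eq_of_lt (by omega),
      show 1 + (a - 1) = a by omega, show 1 + (a - 1 + (m + 1)) = a + (m + 1) by omega] at this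

/-- In a strictly convex `(2m+1)`-gon with `m ≥ 2`, not all distances except the largest one `δ`
occur more than `2m+1` times. -/
theorem not_forall_lt_distMultiplicity_odd {m : ℕ} (h : IsConvexCycle V (2 * m + 1)) (hm : 2 ≤ m) (hVX : ∀ i, V i ∈ X)
    (hcard : X.card = 2 * m + 1) {δ : ℝ} (hδ : δ ∈ distanceSet X)
    (hmax : ∀ d ∈ distanceSet X, d ≤ δ)
    (H : ∀ d ∈ distanceSet X, d ≠ δ → 2 * m + 2 ≤ distMultiplicity X d) : False := by
  have hS : ∀ i j, i < j → j < i + (2 * m + 1) → dist (V i) (V j) ∈ distanceSet X :=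
    fun i j hij hj => dist_mem_distanceSet (hVX i) (hVX j) (h.ne (by omega) hij hj)
  have hsum := card_mul_add_le_choose hδ H
  have hone := one_le_distMultiplicity hδ
  have hge := h.le_card_odd (by omega) hS
  have hch : (2 * m + 1).choose 2 = m * (2 * m + 1) := by
    rw [Nat.choose_two_right, show (2 * m + 1) * (2 * m + 1 - 1) = m * (2 * m + 1) * 2 by
      rw [Nat.add_sub_cancel]; ring]
    exact Nat.mul_div_cancel _ (by norm_num)
  rw [hcard, hch] at hsum
  obtain ⟨D, hD⟩ : ∃ D, (distanceSet X).card = D + 1 := ⟨(distanceSet X).card - 1, by omega⟩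
  rw [hD, Nat.add_sub_cancel] at hsum
  have hle : D + 1 ≤ m := by
    by_contra hcon
    have : m * (2 * m + 2) ≤ D * (2 * m + 2) := Nat.mul_le_mul_right _ (by omega)
    nlinarith
  have hdiag : ∀ i, dist (V i) (V (i + m)) = δ := fun i =>
    le_antisymm (hmax _ (hS _ _ (by omega) (by omega)))
      ((h.main_diagonals_of_odd (by omega) hS (by omega) i).1 δ hδ)
  have hmul : 2 * m + 1 ≤ distMultiplicity X δ := by
    refine le_distMultiplicity (fun i => (V i, V (i + m)))
      (fun i _ => ⟨hVX _, hVX _, h.ne (by omega) (by omega) (by omega), hdiag i⟩) ?_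
    intro i j hij hj heq
    rcases Sym2.eq_iff.1 heq with ⟨h1, h2⟩ | ⟨h1, h2⟩
    · have := h.eq_cases (by omega) (by omega) (by omega) h1
      omega
    · have := h.eq_cases (by omega) (by omega) (by omega) h1
      have := h.eq_cases (by omega) (by omega) (by omega) h2
      omega
  obtain rfl : m = D + 1 := by omega
  nlinarith

/-- In a strictly convex `2(m+1)`-gon with `m ≥ 2`, not all distances except the largest one occur
more than `2(m+1)` times. -/
theorem not_forall_lt_distMultiplicity_even {m : ℕ} (h : IsConvexCycle V (2 * (m + 1))) (hm : 2 ≤ m) (hVX : ∀ i, V i ∈ X)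
    (hcard : X.card = 2 * (m + 1)) {K : ℕ} (hK0 : 0 < K) (hK : K < 2 * (m + 1))
    (hmax : ∀ d ∈ distanceSet X, d ≤ dist (V 0) (V K))
    (H : ∀ d ∈ distanceSet X, d ≠ dist (V 0) (V K) → 2 * (m + 1) + 1 ≤ distMultiplicity X d) :
    False := by
  have hS : ∀ i j, i < j → j < i + 2 * (m + 1) → dist (V i) (V j) ∈ distanceSet X :=
    fun i j hij hj => dist_mem_distanceSet (hVX i) (hVX j) (h.ne (by omega) hij hj)
  have hδ := hS 0 K hK0 (by omega)
  have hsum := card_mul_add_le_choose hδ H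
  have hone := one_le_distMultiplicity hδ
  have hge := h.le_card_even (by omega) hS
  have hch : (2 * (m + 1)).choose 2 = m * (2 * (m + 1) + 1) + 1 := by
    rw [Nat.choose_two_right, show 2 * (m + 1) * (2 * (m + 1) - 1) =
      (m * (2 * (m + 1) + 1) + 1) * 2 by
        rw [show 2 * (m + 1) - 1 = 2 * m + 1 by omega]; ring]
    exact Nat.mul_div_cancel _ (by norm_num)
  rw [hcard, hch] at hsum
  -- Since `n.choose 2 = m (n + 1) + 1`, the count leaves exactly one pair at the largest distance.
  have hD : (distanceSet X).card = m + 1 := by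
    refine le_antisymm ?_ hge
    by_contra hcon
    have : (m + 1) * (2 * (m + 1) + 1) ≤ ((distanceSet X).card - 1) * (2 * (m + 1) + 1) :=
      Nat.mul_le_mul_right _ (by omega)
    nlinarith
  rw [hD, Nat.add_sub_cancel] at hsum
  have huniq : ∀ i j, i < j → j < i + 2 * (m + 1) → dist (V i) (V j) = dist (V 0) (V K) →
      s(V i, V j) = s(V 0, V K) := fun i j hij hj hd =>
    eq_of_distMultiplicity_le_one (by omega) (hVX _) (hVX _) (hVX _) (hVX _)
      (h.ne (by omega) hij hj) (h.ne (by omega) hK0 (by omega)) hd rfl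
  have hKm : K = m + 1 := by
    refine h.diam_span_even (by omega) hS hD.le hK0 hK fun i j hij hj hne => ?_
    refine lt_of_le_of_ne (hmax _ (hS _ _ hij (by omega))) fun heq => ?_
    rcases Sym2.eq_iff.1 (huniq i j hij (by omega) heq) with ⟨h1, h2⟩ | ⟨h1, h2⟩
    · have := h.eq_cases (by omega) (by omega) (by omega) h1
      have := h.eq_cases (by omega) (by omega) (by omega) h2
      omega
    · have := h.eq_cases (by omega) (by omega) (by omega) h2
      omega
  subst hKm
  -- `c` is the deleted end of the diameter. A chord missing `V c` is not the unique diameter, so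
  -- only `m` distances remain available.
  have hS' : ∀ c, c = 0 ∨ c = m + 1 → ∀ a b, 0 < a → a < b → b < 2 * (m + 1) →
      dist (V (c + a)) (V (c + b)) ∈ (distanceSet X).erase (dist (V 0) (V (m + 1))) := by
    intro c hc a b ha hab hb
    refine Finset.mem_erase.2 ⟨fun heq => ?_, hS _ _ (by omega) (by omega)⟩
    rcases Sym2.eq_iff.1 (huniq _ _ (by omega) (by omega) heq) with ⟨h1, h2⟩ | ⟨h1, h2⟩ <;>
    · have := h.eq_cases (by omega) (by omega) (by omega) h1
      have := h.eq_cases (by omega) (by omega) (by omega) h2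
      omega
  have hcard' : ((distanceSet X).erase (dist (V 0) (V (m + 1)))).card = m := by
    rw [Finset.card_erase_of_mem hδ, hD, Nat.add_sub_cancel]
  have hdiag : ∀ c, c = 0 ∨ c = m + 1 → _ := fun c hc =>
    (h.shift c).main_diagonals_of_erase (by omega) hcard'.le (hS' c hc)
  obtain ⟨ε, hε⟩ : ∃ ε, ε = dist (V 1) (V (1 + m)) := ⟨_, rfl⟩
  have hεS : ε ∈ (distanceSet X).erase (dist (V 0) (V (m + 1))) := by
    have := hS' 0 (Or.inl rfl) 1 (1 + m) one_pos (by omega) (by omega)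
    rwa [zero_add, zero_add, ← hε] at this
  have hεmax : ∀ s ∈ (distanceSet X).erase (dist (V 0) (V (m + 1))), s ≤ ε := by
    intro s hs
    have := (hdiag 0 (Or.inl rfl)).1 1 one_pos (by omega) s hs
    rwa [zero_add, zero_add, ← hε] at this
  -- No chord of span `m` contains both ends of the diameter, so each survives in one of the two
  -- smaller polygons.
  have hshort : ∀ j < 2 * (m + 1), dist (V (j + 1)) (V (j + 1 + m)) = ε := by
    intro j hj
    rcases lt_or_ge j (m + 1) with hjm | hjm
    · have h1 := hS' 0 (Or.inl rfl) (j + 1) (j + 1 + m) (by omega) (by omega) (by omega)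
      have h2 := (hdiag 0 (Or.inl rfl)).1 (j + 1) (by omega) (by omega) ε hεS
      rw [zero_add, zero_add] at h1 h2
      exact le_antisymm (hεmax _ h1) h2
    · obtain ⟨i, rfl⟩ : ∃ i, j = m + 1 + i := ⟨j - (m + 1), by omega⟩
      have h1 := hS' (m + 1) (Or.inr rfl) (i + 1) (i + 1 + m) (by omega) (by omega) (by omega)
      have h2 := (hdiag (m + 1) (Or.inr rfl)).1 (i + 1) (by omega) (by omega) ε hεS
      rw [show m + 1 + (i + 1) = m + 1 + i + 1 by ring,
        show m + 1 + (i + 1 + m) = m + 1 + i + 1 + m by ring] at h1 h2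
      exact le_antisymm (hεmax _ h1) h2
  have hlong : ∀ j < m, dist (V (j + 1)) (V (j + 1 + (m + 1))) = ε := by
    intro j hj
    have h1 := hS' 0 (Or.inl rfl) (j + 1) (j + 1 + (m + 1)) (by omega) (by omega) (by omega)
    have h2 := (hdiag 0 (Or.inl rfl)).2 (j + 1) (by omega) (by omega) ε hεS
    rw [zero_add, zero_add] at h1 h2
    exact le_antisymm (hεmax _ h1) h2
  -- All `2(m + 1)` chords of span `m`, and two of the `m` remaining main diagonals; this is where
  -- `m ≥ 2` is needed.
  have hmul : 2 * (m + 1) + 2 ≤ distMultiplicity X ε := by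
    refine le_distMultiplicity (fun j => if j < 2 * (m + 1) then (V (j + 1), V (j + 1 + m)) else
      (V (j - 2 * (m + 1) + 1), V (j - 2 * (m + 1) + 1 + (m + 1)))) (fun j hj => ?_) ?_
    · by_cases hj2 : j < 2 * (m + 1)
      · simp only [if_pos hj2]
        exact ⟨hVX _, hVX _, h.ne (by omega) (by omega) (by omega), hshort j hj2⟩
      · simp only [if_neg hj2]
        exact ⟨hVX _, hVX _, h.ne (by omega) (by omega) (by omega), hlong _ (by omega)⟩
    · intro i j hij hj heq
      by_cases hi2 : i < 2 * (m + 1) <;> by_cases hj2 : j < 2 * (m + 1)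
      · simp only [if_pos hi2, if_pos hj2] at heq
        rcases Sym2.eq_iff.1 heq with ⟨h1, h2⟩ | ⟨h1, h2⟩ <;>
        · have := h.eq_cases (by omega) (by omega) (by omega) h1
          have := h.eq_cases (by omega) (by omega) (by omega) h2
          omega
      · simp only [if_pos hi2, if_neg hj2] at heq
        rcases Sym2.eq_iff.1 heq with ⟨h1, h2⟩ | ⟨h1, h2⟩ <;>
        · have := h.eq_cases (by omega) (by omega) (by omega) h1
          have := h.eq_cases (by omega) (by omega) (by omega) h2
          omega
      · omega
      · simp only [if_neg hi2, if_neg hj2] at heq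
        rcases Sym2.eq_iff.1 heq with ⟨h1, h2⟩ | ⟨h1, h2⟩ <;>
        · have := h.eq_cases (by omega) (by omega) (by omega) h1
          have := h.eq_cases (by omega) (by omega) (by omega) h2
          omega
  have hsum2 := card_mul_add_add_le_choose hδ (Finset.mem_of_mem_erase hεS)
    (Finset.ne_of_mem_erase hεS) H
  rw [hcard, hch, hD] at hsum2
  obtain ⟨l, rfl⟩ : ∃ l, m = l + 1 := ⟨m - 1, by omega⟩
  rw [show l + 1 + 1 - 2 = l by omega] at hsum2
  nlinarith

end IsConvexCycle

end ConvexPosition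

theorem theorem1 (n : ℕ) (hn : 5 ≤ n) (X : Finset (EuclideanSpace ℝ (Fin 2)))
    (hcard : X.card = n) (hconv : InConvexPosition X) :
    ¬ ∀ d ∈ distanceSet X,
        d ≠ Metric.diam (X : Set (EuclideanSpace ℝ (Fin 2))) → n < distMultiplicity X d := by
  intro H
  have hne : X.offDiag.Nonempty := by
    rw [← Finset.card_pos, Finset.offDiag_card, hcard]
    have : n < n * n := by nlinarith
    omega
  obtain ⟨⟨p, q⟩, hpq, hpqmax⟩ := Finset.exists_max_image X.offDiag (fun x => dist x.1 x.2) hne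
  obtain ⟨hp, hq, hpq⟩ := Finset.mem_offDiag.1 hpq
  have hmax : ∀ d ∈ distanceSet X, d ≤ dist p q := by
    intro d hd
    obtain ⟨x, hx, rfl⟩ := Finset.mem_image.1 hd
    exact hpqmax x hx
  have H' : ∀ d ∈ distanceSet X, d ≠ dist p q → n + 1 ≤ distMultiplicity X d := by
    intro d hd hdne
    -- Only `dist p q ≤ diam` is needed: a distance below `dist p q` is then different from the
    -- diameter.
    refine H d hd (ne_of_lt (lt_of_lt_of_le (lt_of_le_of_ne (hmax d hd) hdne) ?_))
    exact Metric.dist_le_diam_of_mem X.finite_toSet.isBounded hp hq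
  obtain ⟨v, hv0, hvX, hsurj, hor⟩ := hconv.exists_orient_pos hcard hp
  have hV := isConvexCycle_of_orient_pos (by omega) hor
  rcases Nat.even_or_odd' n with ⟨m, rfl | rfl⟩
  · obtain ⟨m, rfl⟩ : ∃ l, m = l + 1 := ⟨m - 1, by omega⟩
    obtain ⟨K, hK, hvK⟩ := hsurj q hq
    have hK0 : 0 < K := by
      rcases Nat.eq_zero_or_pos K with rfl | h
      · exact absurd (hv0.symm.trans hvK) hpq
      · exact h
    have e : dist (v (0 % (2 * (m + 1)))) (v (K % (2 * (m + 1)))) = dist p q := by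
      rw [Nat.zero_mod, Nat.mod_eq_of_lt hK, hv0, hvK]
    exact hV.not_forall_lt_distMultiplicity_even (K := K) (by omega) (fun i => hvX _) hcard hK0 hK
      (by simp only [e]; exact hmax) (by simp only [e]; exact H')
  · exact hV.not_forall_lt_distMultiplicity_odd (by omega) (fun i => hvX _) hcard
       (dist_mem_distanceSet hp hq hpq) hmax H'
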